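/- Let $\mathbb K$ be $\mathbb R$ or $\mathbb C$, let $c_0$ be the Banach space of null sequences in $\mathbb K$ with the supremum norm, and let $X$ be a closed linear subspace of $c_0$ whose (topological) dual $X^*$ fails the approximation property. Then there exist a Banach space $Y$ over $\mathbb K$ and a compact linear operator $T\colon X\to Y$ which cannot be approximated by norm-attaining operators, that is, $T$ does not belong to the operator-norm closure of the set of norm-attaining operators in the space $L(X,Y)$ of bounded linear operators from $X$ to $Y$. Here a Banach space $E$ has the approximation property if for every compact set $K\subseteq E$ and every $\varepsilon>0$ there is a bounded finite-rank linear operator $R\colon E\to E$ with $\|x-Rx\|<\varepsilon$ for all $x\in K$; and a bounded linear operator $S\colon X\to Y$ is norm-attaining if there is $x\in X$ with $\|x\|=1$ and $\|S\|=\|Sx\|$. -/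

import Mathlib

universe u

open scoped ZeroAtInfty

/-- The Banach space `c₀` of null sequences in `𝕜` with the supremum norm. This is the space
`C₀(ℕ, 𝕜)` of functions vanishing at infinity on the discrete space `ℕ`; it is given a name so that
its algebraic and topological structures are all derived from the normed space structure. -/
def CZero (𝕜 : Type*) [RCLike 𝕜] : Type _ := C₀(ℕ, 𝕜)

namespace CZero

noncomputable instance (𝕜 : Type*) [RCLike 𝕜] : NormedAddCommGroup (CZero 𝕜) :=
  inferInstanceAs (NormedAddCommGroup C₀(ℕ, 𝕜))

noncomputable instance (𝕜 : Type*) [RCLike 𝕜] : NormedSpace 𝕜 (CZero 𝕜) :=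
  inferInstanceAs (NormedSpace 𝕜 C₀(ℕ, 𝕜))

instance (𝕜 : Type*) [RCLike 𝕜] : FunLike (CZero 𝕜) ℕ 𝕜 :=
  inferInstanceAs (FunLike C₀(ℕ, 𝕜) ℕ 𝕜)

end CZero

/-- A normed space `X` has the (Grothendieck) approximation property if the identity can be
approximated, uniformly on every compact set, by bounded finite-rank operators. -/
def HasApproximationProperty (𝕜 : Type*) [RCLike 𝕜] (X : Type*) [NormedAddCommGroup X]
    [NormedSpace 𝕜 X] : Prop :=
  ∀ K : Set X, IsCompact K → ∀ ε : ℝ, 0 < ε →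
    ∃ R : X →L[𝕜] X, FiniteDimensional 𝕜 R.range ∧ ∀ x ∈ K, ‖x - R x‖ < ε

/-- The set `NA(X, Y)` of norm-attaining bounded operators from `X` to `Y`. -/
def normAttaining (𝕜 : Type*) [RCLike 𝕜] (X Y : Type*) [NormedAddCommGroup X]
    [NormedSpace 𝕜 X] [NormedAddCommGroup Y] [NormedSpace 𝕜 Y] : Set (X →L[𝕜] Y) :=
  {T | ∃ x : X, ‖x‖ = 1 ∧ ‖T‖ = ‖T x‖}

/-!
The proof combines a rigidity property of subspaces of `c₀` with Grothendieck's description of the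
approximation property of a dual space in terms of compact operators.

Rigidity: if `Y` is strictly convex, then every norm-attaining operator from a subspace `X` of `c₀`
to `Y` has finite rank (`finiteDimensional_range_of_mem_normAttaining`). Indeed, a unit vector `x₀`
of `c₀` has small tail, so the unit ball contains a segment centred at `x₀` in every direction
supported far out, and an operator attaining its norm at `x₀` must vanish in these directions.

It remains to find a strictly convex Banach space `Y` and a compact operator `T : X → Y` that is not
a limit of finite-rank operators. Let `K` be a compact subset of `X*` on which the identity cannot
be approximated within `ε` by finite-rank operators. The operator `X → C(K)`, `x ↦ (u ↦ u x)`, is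
compact by Arzelà–Ascoli. The space `C(K)` is given a strictly convex norm by adding, in the `ℓ²`
sense, the norm of `L²(μ)` for a finite measure `μ` of full support on `K`; then `Y` is the closure
of the image of `X`. A finite-rank operator within `ε` of `T` can be perturbed to one of the form
`∑ φᵢ ⊗ T xᵢ`, and evaluating at the points of `K` shows that `u ↦ ∑ u(xᵢ) φᵢ` moves no point of
`K` by `ε` or more (`exists_finiteRank_dual_approx`), which contradicts the choice of `K`.
-/

open scoped BoundedContinuousFunction Topology

section

variable {𝕜 : Type*} [RCLike 𝕜]

theorem CZero.norm_le_iff (x : CZero 𝕜) {C : ℝ} (hC : 0 ≤ C) : ‖x‖ ≤ C ↔ ∀ n, ‖x n‖ ≤ C :=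
  BoundedContinuousFunction.norm_le (f := ZeroAtInftyContinuousMap.toBCF (α := ℕ) (β := 𝕜) x) hC

theorem CZero.exists_forall_ge_norm_le (x : CZero 𝕜) {ε : ℝ} (hε : 0 < ε) :
    ∃ N, ∀ n ≥ N, ‖x n‖ ≤ ε := by
  have h : Filter.Tendsto (fun n => x n) (Filter.cocompact ℕ) (𝓝 0) :=
    (show C₀(ℕ, 𝕜) from x).zero_at_infty'
  rw [cocompact_eq_atTop, Metric.tendsto_atTop] at h
  obtain ⟨N, hN⟩ := h ε hε
  exact ⟨N, fun n hn => by simpa using (hN n hn).le⟩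

variable {Y : Type*} [NormedAddCommGroup Y] [NormedSpace 𝕜 Y]

/-- Every norm-attaining operator from a subspace of `c₀` to a strictly convex space has finite
rank: if it attains its norm at `x₀` and `‖x₀ n‖ ≤ 1 / 2` for `n ≥ N`, then it vanishes at all
vectors supported in `[N, ∞)`, since small multiples of these can be added to and subtracted from
`x₀` without leaving the unit ball. Strict convexity enters as the hypothesis that no nontrivial
segment centred at `a` lies in the ball of radius `‖a‖`. -/
theorem finiteDimensional_range_of_mem_normAttaining (X : Submodule 𝕜 (CZero 𝕜))
    (hY : ∀ a b : Y, ‖a + b‖ ≤ ‖a‖ → ‖a - b‖ ≤ ‖a‖ → b = 0) {T : X →L[𝕜] Y}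
    (hT : T ∈ normAttaining 𝕜 X Y) : FiniteDimensional 𝕜 T.range := by
  obtain ⟨x₀, hx₀, hTx₀⟩ := hT
  obtain ⟨N, hN⟩ := CZero.exists_forall_ge_norm_le (x₀ : CZero 𝕜) (ε := 1 / 2) (by norm_num)
  let e : X →ₗ[𝕜] (Fin N → 𝕜) :=
    { toFun := fun x i => (x : CZero 𝕜) i
      map_add' := fun _ _ => rfl
      map_smul' := fun _ _ => rfl }
  have coord_le (x : X) (n : ℕ) : ‖(x : CZero 𝕜) n‖ ≤ ‖x‖ :=
    (CZero.norm_le_iff _ (norm_nonneg _)).1 le_rfl n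
  -- A perturbation of `x₀` of norm at most `1 / 2` supported in `[N, ∞)` stays in the unit ball.
  have key (z : X) (hz : e z = 0) (hz' : ‖z‖ ≤ 1 / 2) : ‖x₀ + z‖ ≤ 1 := by
    refine (CZero.norm_le_iff _ zero_le_one).2 fun n => ?_
    change ‖(x₀ : CZero 𝕜) n + (z : CZero 𝕜) n‖ ≤ 1
    rcases lt_or_ge n N with hn | hn
    · have : (z : CZero 𝕜) n = 0 := congrFun hz ⟨n, hn⟩
      rw [this, add_zero, ← hx₀]
      exact coord_le x₀ n
    · have := norm_add_le ((x₀ : CZero 𝕜) n) ((z : CZero 𝕜) n)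
      have := hN n hn
      have := coord_le z n
      linarith
  have small (z : X) (hz : e z = 0) (hz' : ‖z‖ ≤ 1 / 2) : T z = 0 := by
    refine hY (T x₀) _ ?_ ?_
    · rw [← map_add, ← hTx₀]
      exact T.unit_le_opNorm _ (key z hz hz')
    · rw [← map_sub, ← hTx₀, sub_eq_add_neg]
      exact T.unit_le_opNorm _ (key (-z) (by simp [hz]) (by simpa using hz'))
  have ker_le : LinearMap.ker e ≤ LinearMap.ker (T : X →ₗ[𝕜] Y) := by
    intro z hz
    by_cases hz0 : z = 0
    · simp [hz0]
    have hz0' : ‖z‖ ≠ 0 := norm_ne_zero_iff.2 hz0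
    have hc : ((1 / 2 * ‖z‖⁻¹ : ℝ) : 𝕜) ≠ 0 := by
      rw [Ne, RCLike.ofReal_eq_zero]; positivity
    have h := small (((1 / 2 * ‖z‖⁻¹ : ℝ) : 𝕜) • z) (by rw [map_smul, hz, smul_zero]) (by
      rw [norm_smul, RCLike.norm_ofReal, abs_of_nonneg (by positivity), mul_assoc,
        inv_mul_cancel₀ hz0', mul_one])
    rw [map_smul] at h
    exact (smul_eq_zero.1 h).resolve_left hc
  have : FiniteDimensional 𝕜 (X ⧸ LinearMap.ker e) :=
    Module.Finite.equiv e.quotKerEquivRange.symm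
  have : FiniteDimensional 𝕜 (X ⧸ LinearMap.ker (T : X →ₗ[𝕜] Y)) :=
    Module.Finite.of_surjective _ (Submodule.factor_surjective ker_le)
  exact Module.Finite.equiv (T : X →ₗ[𝕜] Y).quotKerEquivRange

variable {E : Type*} [NormedAddCommGroup E] [NormedSpace 𝕜 E]

/-- If the functionals in `K` factor through `T : E → Y` with factors in the unit ball of the dual
of `Y`, then approximations of `T` by finite-rank operators yield finite-rank operators on the dual
of `E` approximating the identity on `K`. Since `T` has dense range, the approximating operator may
be taken of the form `∑ φᵢ ⊗ T xᵢ`, and `u ↦ ∑ u(xᵢ) φᵢ` is then the operator sought. -/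
theorem exists_finiteRank_dual_approx {T : E →L[𝕜] Y} (hT : DenseRange T)
    {K : Set (StrongDual 𝕜 E)} (hK : ∀ u ∈ K, ∃ g : Y →L[𝕜] 𝕜, ‖g‖ ≤ 1 ∧ ∀ x, g (T x) = u x)
    {R : E →L[𝕜] Y} [FiniteDimensional 𝕜 R.range] {ε : ℝ} (hR : ‖T - R‖ < ε) :
    ∃ S : StrongDual 𝕜 E →L[𝕜] StrongDual 𝕜 E,
      FiniteDimensional 𝕜 S.range ∧ ∀ u ∈ K, ‖u - S u‖ < ε := by
  let b := Module.finBasis 𝕜 R.range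
  let φ : Fin (Module.finrank 𝕜 R.range) → StrongDual 𝕜 E := fun i =>
    (LinearMap.toContinuousLinearMap (b.coord i)) ∘L R.rangeRestrict
  have hRφ : R = ∑ i, (φ i).smulRight (b i : Y) := by
    ext x
    have h := congrArg Subtype.val (b.sum_repr (R.rangeRestrict x))
    rw [AddSubmonoidClass.coe_finsetSum] at h
    rw [sum_apply]
    exact h.symm
  have hopen : IsOpen {d : Fin (Module.finrank 𝕜 R.range) → Y |
      ‖T - ∑ i, (φ i).smulRight (d i)‖ < ε} := by
    refine isOpen_lt (Continuous.norm (continuous_const.sub (continuous_finsetSum _ fun i _ => ?_)))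
      continuous_const
    exact (ContinuousLinearMap.smulRightL 𝕜 E Y (φ i)).continuous.comp (continuous_apply i)
  obtain ⟨x, hx⟩ := (DenseRange.piMap fun _ => hT).exists_mem_open hopen
    ⟨fun i => (b i : Y), by simpa [← hRφ] using hR⟩
  replace hx : ‖T - ∑ i, (φ i).smulRight (T (x i))‖ < ε := hx
  let S : StrongDual 𝕜 E →L[𝕜] StrongDual 𝕜 E :=
    ∑ i, (ContinuousLinearMap.apply 𝕜 𝕜 (x i)).smulRight (φ i)
  have hS (u) : S u = ∑ i, u (x i) • φ i := by simp [S]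
  refine ⟨S, ?_, fun u hu => ?_⟩
  · have := FiniteDimensional.span_of_finite 𝕜 (Set.finite_range φ)
    refine Submodule.finiteDimensional_of_le (S₂ := Submodule.span 𝕜 (Set.range φ)) ?_
    rintro _ ⟨u, rfl⟩
    change S u ∈ _
    rw [hS]
    exact Submodule.sum_mem _ fun i _ =>
      Submodule.smul_mem _ _ (Submodule.subset_span (Set.mem_range_self i))
  · obtain ⟨g, hg, hgT⟩ := hK u hu
    have : u - S u = g ∘L (T - ∑ i, (φ i).smulRight (T (x i))) := by
      ext y
      simp [hS, hgT, mul_comm]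
    rw [this]
    refine lt_of_le_of_lt (ContinuousLinearMap.opNorm_comp_le _ _) (lt_of_le_of_lt ?_ hx)
    exact mul_le_of_le_one_left (norm_nonneg _) hg

theorem exists_finiteRank_dual_approx_of_mem_closure (X : Submodule 𝕜 (CZero 𝕜))
    (hY : ∀ a b : Y, ‖a + b‖ ≤ ‖a‖ → ‖a - b‖ ≤ ‖a‖ → b = 0) {T : X →L[𝕜] Y} (hT : DenseRange T)
    {K : Set (StrongDual 𝕜 X)} (hK : ∀ u ∈ K, ∃ g : Y →L[𝕜] 𝕜, ‖g‖ ≤ 1 ∧ ∀ x, g (T x) = u x)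
    (hcl : T ∈ closure (normAttaining 𝕜 X Y)) {ε : ℝ} (hε : 0 < ε) :
    ∃ S : StrongDual 𝕜 X →L[𝕜] StrongDual 𝕜 X,
      FiniteDimensional 𝕜 S.range ∧ ∀ u ∈ K, ‖u - S u‖ < ε := by
  obtain ⟨R, hR, hTR⟩ := Metric.mem_closure_iff.1 hcl ε hε
  rw [dist_eq_norm] at hTR
  have := finiteDimensional_range_of_mem_normAttaining X hY hR
  exact exists_finiteRank_dual_approx hT hK hTR

/-- A nonempty separable space carries a finite Borel measure of full support: a weighted sum of
point masses along a dense sequence. -/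
theorem exists_isFiniteMeasure_isOpenPosMeasure (K : Type*) [TopologicalSpace K]
    [TopologicalSpace.SeparableSpace K] [Nonempty K] [MeasurableSpace K] [BorelSpace K] :
    ∃ μ : MeasureTheory.Measure K,
      MeasureTheory.IsFiniteMeasure μ ∧ μ.IsOpenPosMeasure := by
  let x := TopologicalSpace.denseSeq K
  refine ⟨.sum fun n => (2⁻¹ : ENNReal) ^ n • .dirac (x n), ⟨?_⟩, ⟨fun U hU hne h => ?_⟩⟩
  · rw [MeasureTheory.Measure.sum_apply _ MeasurableSet.univ]
    simp [ENNReal.tsum_geometric]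
  · obtain ⟨n, hn⟩ := (TopologicalSpace.denseRange_denseSeq K).exists_mem_open hU hne
    rw [MeasureTheory.Measure.sum_apply _ hU.measurableSet, ENNReal.tsum_eq_zero] at h
    have := h n
    simp [hU.measurableSet, x, hn] at this

/-- The evaluation operator `x ↦ (u ↦ u x)` from `E` to the functions on a compact set of
functionals. -/
noncomputable def dualEval (K : Set (StrongDual 𝕜 E)) [CompactSpace K] : E →L[𝕜] (K →ᵇ 𝕜) :=
  LinearMap.mkContinuousOfExistsBound
    { toFun := fun x => BoundedContinuousFunction.mkOfCompact ⟨fun u : K => u.1 x, by fun_prop⟩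
      map_add' := fun x y => by ext u; simp
      map_smul' := fun c x => by ext u; simp }
    (by
      obtain ⟨C, hC⟩ := (isCompact_iff_compactSpace.2 ‹CompactSpace K›).isBounded.exists_norm_le
      refine ⟨max C 0, fun x => ?_⟩
      refine (BoundedContinuousFunction.norm_le (by positivity)).2 fun u => ?_
      refine (u.1.le_opNorm x).trans ?_
      gcongr
      exact (hC u.1 u.2).trans (le_max_left _ _))

@[simp]
theorem dualEval_apply (K : Set (StrongDual 𝕜 E)) [CompactSpace K] (x : E) (u : K) :
    dualEval K x u = u.1 x := rfl

/-- The functions `u ↦ u x` with `‖x‖ ≤ 1` are uniformly bounded and `1`-Lipschitz on `K`, so that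
the Arzelà–Ascoli theorem applies. -/
theorem isCompactOperator_dualEval (K : Set (StrongDual 𝕜 E)) [CompactSpace K] :
    IsCompactOperator (dualEval K) := by
  refine (isCompactOperator_iff_isCompact_closure_image_closedBall
    (dualEval K : E →ₗ[𝕜] (K →ᵇ 𝕜)) one_pos).2 ?_
  refine BoundedContinuousFunction.arzela_ascoli (Metric.closedBall 0 ‖dualEval K‖)
    (isCompact_closedBall _ _) _ ?_ ?_
  · rintro _ u ⟨x, hx, rfl⟩
    rw [mem_closedBall_zero_iff] at hx ⊢
    exact (BoundedContinuousFunction.norm_coe_le_norm _ u).trans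
      ((dualEval K).unit_le_opNorm x hx)
  · refine Metric.equicontinuous_of_continuity_modulus (fun t => t)
      Filter.tendsto_id _ ?_
    rintro u v ⟨_, x, hx, rfl⟩
    rw [mem_closedBall_zero_iff] at hx
    change dist (u.1 x) (v.1 x) ≤ dist u v
    rw [dist_eq_norm, Subtype.dist_eq, dist_eq_norm, ← sub_apply]
    exact (u.1 - v.1).unit_le_opNorm x hx

/-- In a product with the `ℓ²` norm whose second factor is a Hilbert space, if the segment
`[a - b, a + b]` lies in the ball of radius `‖a‖`, then `b` has zero Hilbert component, by the
parallelogram identity. -/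
theorem snd_eq_zero_of_norm_add_le_of_norm_sub_le {F H : Type*} [NormedAddCommGroup F] [NormedSpace 𝕜 F]
    [NormedAddCommGroup H] [InnerProductSpace 𝕜 H] {a b : WithLp 2 (F × H)}
    (h₁ : ‖a + b‖ ≤ ‖a‖) (h₂ : ‖a - b‖ ≤ ‖a‖) : b.snd = 0 := by
  have e₀ := WithLp.prod_norm_sq_eq_of_L2 a
  have e₁ := WithLp.prod_norm_sq_eq_of_L2 (a + b)
  have e₂ := WithLp.prod_norm_sq_eq_of_L2 (a - b)
  rw [WithLp.add_fst, WithLp.add_snd] at e₁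
  rw [WithLp.sub_fst, WithLp.sub_snd] at e₂
  have par := parallelogram_law_with_norm 𝕜 a.snd b.snd
  have tri : 2 * ‖a.fst‖ ≤ ‖a.fst + b.fst‖ + ‖a.fst - b.fst‖ := by
    have h := norm_add_le (a.fst + b.fst) (a.fst - b.fst)
    rwa [add_add_sub_cancel, ← two_smul 𝕜 a.fst, norm_smul, RCLike.norm_ofNat] at h
  have s₁ : ‖a + b‖ ^ 2 ≤ ‖a‖ ^ 2 := by gcongr
  have s₂ : ‖a - b‖ ^ 2 ≤ ‖a‖ ^ 2 := by gcongr
  have s₃ : (2 * ‖a.fst‖) ^ 2 ≤ (‖a.fst + b.fst‖ + ‖a.fst - b.fst‖) ^ 2 := by gcongr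
  have : ‖b.snd‖ ^ 2 ≤ 0 := by
    nlinarith [sq_nonneg (‖a.fst + b.fst‖ - ‖a.fst - b.fst‖)]
  simpa using le_antisymm this (sq_nonneg _)

end

theorem mainTheorem3 {𝕜 : Type u} [RCLike 𝕜] (X : Submodule 𝕜 (CZero 𝕜))
    (hX : IsClosed (X : Set (CZero 𝕜)))
    (hAP : ¬ HasApproximationProperty 𝕜 (StrongDual 𝕜 X)) :
    ∃ (Y : Type u) (_ : NormedAddCommGroup Y) (_ : NormedSpace 𝕜 Y) (_ : CompleteSpace Y)
      (T : X →L[𝕜] Y), IsCompactOperator T ∧ T ∉ closure (normAttaining 𝕜 X Y) := by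
  unfold HasApproximationProperty at hAP
  push Not at hAP
  obtain ⟨K, hK, ε, hε, hKε⟩ := hAP
  have : CompactSpace K := isCompact_iff_compactSpace.1 hK
  have : Nonempty K := by
    obtain ⟨u, hu, -⟩ := hKε 0 (Submodule.finiteDimensional_of_le (S₂ := ⊥)
      (by rintro _ ⟨u, rfl⟩; simp))
    exact ⟨u, hu⟩
  let _ : MeasurableSpace K := borel K
  have : BorelSpace K := ⟨rfl⟩
  obtain ⟨μ, _, _⟩ := exists_isFiniteMeasure_isOpenPosMeasure K
  let H := MeasureTheory.Lp 𝕜 2 μ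
  let D : (K →ᵇ 𝕜) →L[𝕜] H := BoundedContinuousFunction.toLp 2 μ 𝕜
  have hD : Function.Injective D := BoundedContinuousFunction.toLp_injective μ
  -- The norm of `J f` is the strictly convex norm `(‖f‖² + ‖D f‖²)^(1/2)`, equivalent to `‖f‖`.
  let J : (K →ᵇ 𝕜) →L[𝕜] WithLp 2 ((K →ᵇ 𝕜) × H) :=
    ((WithLp.prodContinuousLinearEquiv 2 𝕜 (K →ᵇ 𝕜) H).symm : _ →L[𝕜] _) ∘L
      (ContinuousLinearMap.id 𝕜 _).prod D
  let T₀ : X →L[𝕜] WithLp 2 ((K →ᵇ 𝕜) × H) := J ∘L dualEval K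
  let Y := T₀.range.topologicalClosure
  have hYD : ∀ y ∈ Y, y.snd = D y.fst := by
    have hcl : IsClosed {y : WithLp 2 ((K →ᵇ 𝕜) × H) | y.snd = D y.fst} :=
      isClosed_eq (WithLp.sndL 2 𝕜 (K →ᵇ 𝕜) H).continuous
        (D.continuous.comp (WithLp.fstL 2 𝕜 (K →ᵇ 𝕜) H).continuous)
    refine fun y hy => closure_minimal ?_ hcl hy
    rintro _ ⟨x, rfl⟩
    rfl
  have hYconv (a b : Y) (h₁ : ‖a + b‖ ≤ ‖a‖) (h₂ : ‖a - b‖ ≤ ‖a‖) : b = 0 := by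
    have hs : b.1.snd = 0 := snd_eq_zero_of_norm_add_le_of_norm_sub_le (𝕜 := 𝕜) h₁ h₂
    have hf : b.1.fst = 0 := hD (by rw [← hYD _ b.2, hs, map_zero])
    rw [← Submodule.coe_eq_zero, ← norm_eq_zero, ← sq_eq_zero_iff, WithLp.prod_norm_sq_eq_of_L2,
      hs, hf]
    simp
  have hYclosed : IsClosed (Y : Set (WithLp 2 ((K →ᵇ 𝕜) × H))) :=
    Submodule.isClosed_topologicalClosure _
  have hmem (x : X) : T₀ x ∈ Y := subset_closure ⟨x, rfl⟩
  let T : X →L[𝕜] Y := T₀.codRestrict Y hmem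
  have hTc : IsCompactOperator T :=
    ((isCompactOperator_dualEval K).clm_comp J).codRestrict hmem hYclosed
  have hTd : DenseRange T := by
    intro y
    rw [closure_subtype]
    refine closure_mono ?_ y.2
    rintro _ ⟨x, rfl⟩
    exact ⟨T x, ⟨x, rfl⟩, rfl⟩
  have hYcomplete : CompleteSpace Y := hYclosed.completeSpace_coe
  have hfac : ∀ u ∈ K, ∃ g : Y →L[𝕜] 𝕜, ‖g‖ ≤ 1 ∧ ∀ x, g (T x) = u x := by
    intro u hu
    -- The functional `u` factors through `T` as evaluation at the point `u` of `K`.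
    refine ⟨LinearMap.mkContinuous
      { toFun := fun y => y.1.fst ⟨u, hu⟩
        map_add' := fun _ _ => rfl
        map_smul' := fun _ _ => rfl } 1 fun y => ?_, LinearMap.mkContinuous_norm_le _ zero_le_one _,
      fun x => rfl⟩
    rw [one_mul]
    refine (BoundedContinuousFunction.norm_coe_le_norm _ _).trans ?_
    refine (pow_le_pow_iff_left₀ (norm_nonneg _) (norm_nonneg _) two_ne_zero).1 ?_
    rw [Submodule.coe_norm, WithLp.prod_norm_sq_eq_of_L2]
    exact le_add_of_nonneg_right (sq_nonneg _)
  refine ⟨Y, inferInstance, inferInstance, hYcomplete, T, hTc, fun hcl => ?_⟩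
  obtain ⟨S, hS, hSK⟩ :=
    exists_finiteRank_dual_approx_of_mem_closure X hYconv hTd hfac hcl hε
  obtain ⟨u, hu, hle⟩ := hKε S hS
  exact (hSK u hu).not_ge hle
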